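/- **Theorem.** Let $\operatorname{Im}\tau>0$ and let $$\theta_1(u|\tau)=-i\sum_{k\in\mathbb Z}(-1)^k e^{\pi i\tau(k+\frac12)^2}e^{\pi i(2k+1)u},\qquad \theta_2(u|\tau)=\sum_{k\in\mathbb Z}e^{\pi i\tau(k+\frac12)^2}e^{\pi i(2k+1)u},$$ $$\theta_3(u|\tau)=\sum_{k\in\mathbb Z}e^{\pi i\tau k^2}e^{2\pi iku},\qquad \theta_4(u|\tau)=\sum_{k\in\mathbb Z}(-1)^ke^{\pi i\tau k^2}e^{2\pi iku}$$ be the Jacobi theta functions (with modulus $\tau$ where it is omitted). Let $\omega_0=0$, $\omega_1=\frac12$, $\omega_2=\frac{1+\tau}2$, $\omega_3=\frac\tau2$, and put $$\phi(x,u)=\frac{\theta_1'(0)\,\theta_1(x+u)}{\theta_1(x)\,\theta_1(u)},\qquad \varphi_a(x,u+\omega_a)=e^{2\pi i x\,\partial_\tau\omega_a}\phi(x,u+\omega_a)\quad(a=0,1,2,3),$$ $$\varphi_\alpha(x)=\varphi_\alpha(x,\omega_\alpha)\quad(\alpha=1,2,3),\qquad v(x,u|\nu)=\sum_{a=0}^3\nu_a\,\varphi_a(2x,u+\omega_a)\quad\text{for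 }\nu=(\nu_0,\nu_1,\nu_2,\nu_3)\in\mathbb C^4.$$ Define $c_1=-\big(\theta_2(0)/\theta_1'(0)\big)^2$, $c_2=-i\big(\theta_3(0)/\theta_1'(0)\big)^2$, $c_3=-\big(\theta_4(0)/\theta_1'(0)\big)^2$, and the dual constants $$\begin{pmatrix}\breve\nu_0\\ \breve\nu_1\\ \breve\nu_2\\ \breve\nu_3\end{pmatrix}=\frac12\begin{pmatrix}1&1&1&1\\1&1&-1&-1\\1&-1&1&-1\\1&-1&-1&1\end{pmatrix}\begin{pmatrix}\nu_0\\ \nu_1\\ \nu_2\\ \nu_3\end{pmatrix},\qquad \breve v(x,u)=v(x,u|\breve\nu).$$ Let $\nu\in\mathbb C^4$, $c\in\mathbb C\setminus\{0\}$ and $p,q,\eta,z\in\mathbb C$ with $\theta_1(2q)\ne0$, $\theta_1(2\eta)\ne0$, $\theta_1(2z)\ne0$, and write $v(x,u)=v(x,u|\nu)$. Consider the Lax matrix of the 4-constant $\mathrm{BC}_1$ Ruijsenaars–van Diejen model and the IRF–Vertex matrix $$L(z)=\begin{pmatrix}v(\eta,q)e^{p/2c}&v(z,q)\\ v(z,-q)&v(\eta,-q)e^{-p/2c}\end{pmatrix},\qquad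 \Xi(z)=\begin{pmatrix}\theta_3(z-2q|2\tau)&-\theta_3(z+2q|2\tau)\\-\theta_2(z-2q|2\tau)&\theta_2(z+2q|2\tau)\end{pmatrix}.$$ Then $\breve v(q,\eta)=v(\eta,q)$, the matrix $\Xi(z)$ is invertible, the numbers $c_\alpha$ and $\varphi_\alpha(z)$ ($\alpha=1,2,3$) are nonzero, and $\Xi(z)L(z)\Xi(z)^{-1}$ is the Lax matrix of the relativistic Zhukovsky–Volterra gyrostat, $$\Xi(z)\,L(z)\,\Xi(z)^{-1}=S_0\,\sigma_0+\sum_{\alpha=1}^3\Big(S_\alpha\,\varphi_\alpha(z)-\frac{\lambda_\alpha}{\varphi_\alpha(z)}\Big)\sigma_{4-\alpha},$$ where $\sigma_0$ is the identity matrix, $\sigma_1,\sigma_2,\sigma_3$ are the Pauli matrices, $\lambda_\alpha=\breve\nu_\alpha/c_\alpha$, and the variables $S_0,S_\alpha$, which do not depend on $z$, are $$S_0(p,q)=\frac12\Big(\breve v(q,\eta)e^{p/2c}+\breve v(-q,\eta)e^{-p/2c}\Big),$$ $$S_\alpha(p,q)=\frac{c_\alpha}2\Big(\breve v(q,\eta)e^{p/2c}-\breve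 v(-q,\eta)e^{-p/2c}\Big)\varphi_\alpha(2q)+c_\alpha\breve\nu_0\,\varphi_\beta(2q)\varphi_\gamma(2q)+c_\alpha\varphi_\alpha(2q)\sum_{k=1}^3\breve\nu_k\varphi_k(2q),$$ with $\{\alpha,\beta,\gamma\}=\{1,2,3\}$. -/

import Mathlib

noncomputable section

namespace Ruijsenaars

open Complex Matrix

/-- First Jacobi theta function `θ₁(u|τ)`, also written `ϑ(u)`. -/
def theta1 (τ u : ℂ) : ℂ :=
  -I * ∑' k : ℤ, (-1 : ℂ) ^ k * exp (Real.pi * I * τ * ((k : ℂ) + 1 / 2) ^ 2)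
    * exp (Real.pi * I * (2 * (k : ℂ) + 1) * u)

/-- Second Jacobi theta function `θ₂(u|τ)`. -/
def theta2 (τ u : ℂ) : ℂ :=
  ∑' k : ℤ, exp (Real.pi * I * τ * ((k : ℂ) + 1 / 2) ^ 2)
    * exp (Real.pi * I * (2 * (k : ℂ) + 1) * u)

/-- Third Jacobi theta function `θ₃(u|τ)`. -/
def theta3 (τ u : ℂ) : ℂ :=
  ∑' k : ℤ, exp (Real.pi * I * τ * (k : ℂ) ^ 2) * exp (2 * Real.pi * I * (k : ℂ) * u)

/-- Fourth Jacobi theta function `θ₄(u|τ)`. -/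
def theta4 (τ u : ℂ) : ℂ :=
  ∑' k : ℤ, (-1 : ℂ) ^ k * exp (Real.pi * I * τ * (k : ℂ) ^ 2)
    * exp (2 * Real.pi * I * (k : ℂ) * u)

/-- The theta constant `ϑ'(0) = θ₁'(0|τ)`. -/
def theta1Deriv (τ : ℂ) : ℂ := deriv (theta1 τ) 0

/-- The half-periods `ω₀ = 0, ω₁ = 1/2, ω₂ = (1+τ)/2, ω₃ = τ/2`. -/
def halfPeriod (τ : ℂ) : Fin 4 → ℂ := ![0, 1 / 2, (1 + τ) / 2, τ / 2]

/-- The numbers `∂ω_a/∂τ`. -/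
def halfPeriodSlope : Fin 4 → ℂ := ![0, 0, 1 / 2, 1 / 2]

/-- The elliptic Kronecker function `φ(z,u) = ϑ'(0) ϑ(z+u) / (ϑ(z) ϑ(u))`. -/
def kronecker (τ z u : ℂ) : ℂ :=
  theta1Deriv τ * theta1 τ (z + u) / (theta1 τ z * theta1 τ u)

/-- `varphi τ a z x` is `φ_a(z, x + ω_a) = exp(2πi z ∂_τ ω_a) φ(z, x + ω_a)`, `a = 0,1,2,3`. -/
def varphi (τ : ℂ) (a : Fin 4) (z x : ℂ) : ℂ :=
  exp (2 * Real.pi * I * z * halfPeriodSlope a) * kronecker τ z (x + halfPeriod τ a)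

/-- The one-variable functions `φ_α(z) = φ_α(z, ω_α)`, `α = 1,2,3`.
Throughout, the indices `α = 1,2,3` are represented by `0,1,2 : Fin 3`. -/
def varphi₁ (τ : ℂ) (α : Fin 3) (z : ℂ) : ℂ := varphi τ α.succ z 0

/-- `v(z,u|ν) = ∑_a ν_a φ_a(2z, u + ω_a)`. -/
def v (τ : ℂ) (ν : Fin 4 → ℂ) (z u : ℂ) : ℂ := ∑ a : Fin 4, ν a * varphi τ a (2 * z) u

/-- The dual constants `ν̆`. -/
def dual (ν : Fin 4 → ℂ) : Fin 4 → ℂ :=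
  ((1 / 2 : ℂ) • !![1, 1, 1, 1; 1, 1, -1, -1; 1, -1, 1, -1; 1, -1, -1, 1]) *ᵥ ν

/-- The constants `c_1, c_2, c_3`. -/
def thetaConst (τ : ℂ) : Fin 3 → ℂ :=
  ![-(theta2 τ 0 / theta1Deriv τ) ^ 2, -I * (theta3 τ 0 / theta1Deriv τ) ^ 2,
    -(theta4 τ 0 / theta1Deriv τ) ^ 2]

/-- The Lax matrix `L(z)` of the 4-constant `BC₁` Ruijsenaars-van Diejen model, at the point
`(p, q)` of the phase space. -/
def laxRvD (τ c η : ℂ) (ν : Fin 4 → ℂ) (p q z : ℂ) : Matrix (Fin 2) (Fin 2) ℂ :=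
  !![v τ ν η q * exp (p / (2 * c)), v τ ν z q;
     v τ ν z (-q), v τ ν η (-q) * exp (-p / (2 * c))]

/-- The IRF-Vertex matrix `Ξ(z)`. -/
def Xi (τ q z : ℂ) : Matrix (Fin 2) (Fin 2) ℂ :=
  !![theta3 (2 * τ) (z - 2 * q), -theta3 (2 * τ) (z + 2 * q);
     -theta2 (2 * τ) (z - 2 * q), theta2 (2 * τ) (z + 2 * q)]

/-- The Pauli matrices in the order `σ₃, σ₂, σ₁`, that is `σ_{4-α}` for `α = 1,2,3`. -/
def sigmaRev : Fin 3 → Matrix (Fin 2) (Fin 2) ℂ :=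
  ![!![1, 0; 0, -1], !![0, -I; I, 0], !![0, 1; 1, 0]]

/-- The Lax matrix of the relativistic Zhukovsky-Volterra gyrostat with dynamical variables
`S₀, S_α` and parameters `λ_α`. -/
def laxZhV (τ S₀ : ℂ) (S lam : Fin 3 → ℂ) (z : ℂ) : Matrix (Fin 2) (Fin 2) ℂ :=
  S₀ • (1 : Matrix (Fin 2) (Fin 2) ℂ)
    + ∑ α : Fin 3, (S α * varphi₁ τ α z - lam α / varphi₁ τ α z) • sigmaRev α

/-- `S₀(p,q)`. -/
def S0 (τ c η : ℂ) (ν : Fin 4 → ℂ) (p q : ℂ) : ℂ :=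
  1 / 2 * (v τ (dual ν) q η * exp (p / (2 * c)) + v τ (dual ν) (-q) η * exp (-p / (2 * c)))

/-- `S_α(p,q)`. The two indices in `Fin 3` other than `α` are `α + 1` and `α + 2`. -/
def S (τ c η : ℂ) (ν : Fin 4 → ℂ) (p q : ℂ) (α : Fin 3) : ℂ :=
  thetaConst τ α / 2
      * (v τ (dual ν) q η * exp (p / (2 * c)) - v τ (dual ν) (-q) η * exp (-p / (2 * c)))
      * varphi₁ τ α (2 * q)
    + thetaConst τ α * dual ν 0 * varphi₁ τ (α + 1) (2 * q) * varphi₁ τ (α + 2) (2 * q)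
    + thetaConst τ α * varphi₁ τ α (2 * q) * ∑ k : Fin 3, dual ν k.succ * varphi₁ τ k (2 * q)

end Ruijsenaars

end

/-!
The four theta functions are instances of one series with characteristic, `thetaChar`. Splitting the
double series of a product of two such series by the parity of `m + n` (`thetaChar_mul`) expresses
`θ_a(x|τ) θ_a(y|τ)` bilinearly through `θ₂, θ₃` with modulus `2τ`, and `θ₁(x|τ) θ₂(y|τ)`,
`θ₃(x|τ) θ₄(y|τ)` through `θ₁, θ₄` with modulus `2τ`, at the arguments `x + y` and `x - y`. Every
addition formula below, quartic ones included, then becomes a polynomial identity.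

Nonvanishing: `θ₃(0|τ)` is Mathlib's `jacobiTheta τ` and `θ₄(0|τ) = jacobiTheta (τ + 1)`. The
relation `θ₃(0|τ) θ₄(0|τ) = θ₄(0|2τ)²` propagates a zero of `jacobiTheta` to points of imaginary
part tending to infinity, where `jacobiTheta` tends to `1`, so there is none; `θ₂(0)` follows by the
inversion `τ ↦ -1/τ`. The duplication formula `theta1_two_mul` forces the zero of `θ₁` at the origin
to be simple, that is `θ₁'(0) ≠ 0`, and shows that `θ₁(2x) ≠ 0` implies `θ_a(x) ≠ 0` for all `a`.

Up to an exponential factor the shift of `θ₁` by `ω_a` is `θ_{a+1}`, whence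
`φ_a(x, u + ω_a) = θ₁'(0) θ_{a+1}(x + u) / (θ₁(x) θ_{a+1}(u))` without any exponential
(`varphi_eq_thetaFn`). The duality `v(q, η | ν̆) = v(η, q | ν)` is, coefficient by coefficient in `ν`,
one of the four Riemann relations (`riemann_theta_relations`).

For the conjugation, the entries of `Ξ L adj Ξ` are bilinear in those of `Ξ`, so the bilinear
formulas turn the coefficient of each Pauli matrix into a combination of
`θ_{α+1}(z) θ_{α+1}(2q)` (from the diagonal of `L`) and of `θ_{α+1}(z ∓ 2q) v(z, ±q)` (from the
off-diagonal). Rewriting `v(z, ±q)` by duality as `v(±q, z | ν̆)` reduces the claim to one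
addition formula for each pair consisting of `α` and an index of `ν̆`; `gyrostat_coefficient` carries
out this computation for the three values of `α` at once.
-/

noncomputable section

namespace Ruijsenaars

open Complex Matrix

/-! ### Theta series with characteristic -/

/-- The theta series `∑ₖ exp(πiτ(k + c)² + 2πi(k + c)x)`. Only the characteristic that shifts the
summation index is a parameter: the other one is a translation of `x`. -/
def thetaChar (τ c x : ℂ) : ℂ :=
  ∑' k : ℤ, exp (Real.pi * I * τ * (k + c) ^ 2 + 2 * Real.pi * I * (k + c) * x)

theorem exp_thetaChar_term (τ c x : ℂ) (k : ℤ) :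
    exp (Real.pi * I * τ * (k + c) ^ 2 + 2 * Real.pi * I * (k + c) * x) =
      exp (Real.pi * I * τ * c ^ 2 + 2 * Real.pi * I * c * x) *
        jacobiTheta₂_term k (x + c * τ) τ := by
  rw [jacobiTheta₂_term, ← exp_add]
  congr 1
  ring

theorem thetaChar_eq_jacobiTheta₂ (τ c x : ℂ) :
    thetaChar τ c x =
      exp (Real.pi * I * τ * c ^ 2 + 2 * Real.pi * I * c * x) * jacobiTheta₂ (x + c * τ) τ := by
  simp only [thetaChar, exp_thetaChar_term, tsum_mul_left, jacobiTheta₂]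

theorem summable_thetaChar {τ : ℂ} (hτ : 0 < τ.im) (c x : ℂ) :
    Summable fun k : ℤ =>
      exp (Real.pi * I * τ * (k + c) ^ 2 + 2 * Real.pi * I * (k + c) * x) := by
  simp only [exp_thetaChar_term]
  exact ((summable_jacobiTheta₂_term_iff _ _).2 hτ).mul_left _

theorem thetaChar_char_add_one (τ c x : ℂ) : thetaChar τ (c + 1) x = thetaChar τ c x := by
  unfold thetaChar
  rw [← (Equiv.addRight (1 : ℤ)).tsum_eq
    (fun k : ℤ => exp (Real.pi * I * τ * (k + c) ^ 2 + 2 * Real.pi * I * (k + c) * x))]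
  refine tsum_congr fun k => ?_
  simp only [Equiv.coe_addRight, Int.cast_add, Int.cast_one]
  congr 1
  ring

theorem thetaChar_neg (τ c x : ℂ) : thetaChar τ (-c) (-x) = thetaChar τ c x := by
  unfold thetaChar
  rw [← (Equiv.neg ℤ).tsum_eq
    (fun k : ℤ => exp (Real.pi * I * τ * (k + c) ^ 2 + 2 * Real.pi * I * (k + c) * x))]
  refine tsum_congr fun k => ?_
  simp only [Equiv.neg_apply, Int.cast_neg]
  congr 1
  ring

theorem thetaChar_add_one (τ c x : ℂ) :
    thetaChar τ c (x + 1) = exp (2 * Real.pi * I * c) * thetaChar τ c x := by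
  unfold thetaChar
  rw [← tsum_mul_left]
  refine tsum_congr fun k => ?_
  rw [← exp_add, Complex.exp_eq_exp_iff_exists_int]
  exact ⟨k, by ring⟩

theorem thetaChar_add_mul_modulus (τ c d x : ℂ) :
    thetaChar τ c (x + d * τ) =
      exp (-(Real.pi * I * τ * d ^ 2 + 2 * Real.pi * I * d * x)) * thetaChar τ (c + d) x := by
  unfold thetaChar
  rw [← tsum_mul_left]
  refine tsum_congr fun k => ?_
  rw [← exp_add]
  congr 1
  ring

/-- The substitution `(m, n) = (j + l + ε, j - l)`, where `ε ∈ {0, 1}` is the parity of `m + n`,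
as a bijection from two copies of `ℤ × ℤ` to `ℤ × ℤ`. -/
def sumDiffEquiv : (ℤ × ℤ) ⊕ (ℤ × ℤ) ≃ ℤ × ℤ :=
  Equiv.ofBijective
    (Sum.elim (fun p => (p.1 + p.2, p.1 - p.2)) fun p => (p.1 + p.2 + 1, p.1 - p.2)) (by
      constructor
      · rintro (⟨a, b⟩ | ⟨a, b⟩) (⟨c, d⟩ | ⟨c, d⟩) h <;>
          simp only [Sum.elim_inl, Sum.elim_inr, Prod.mk.injEq] at h <;>
          first | (exfalso; omega) | (congr 2 <;> omega)
      · rintro ⟨m, n⟩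
        rcases Int.even_or_odd' (m + n) with ⟨j, h | h⟩
        · exact ⟨Sum.inl (j, m - j), by simp only [Sum.elim_inl, Prod.mk.injEq]; omega⟩
        · exact ⟨Sum.inr (j, m - j - 1), by simp only [Sum.elim_inr, Prod.mk.injEq]; omega⟩)

theorem sumDiffEquiv_inl (p : ℤ × ℤ) : sumDiffEquiv (Sum.inl p) = (p.1 + p.2, p.1 - p.2) := rfl

theorem sumDiffEquiv_inr (p : ℤ × ℤ) :
    sumDiffEquiv (Sum.inr p) = (p.1 + p.2 + 1, p.1 - p.2) := rfl

/-- Splitting the double series of a product of two theta series of modulus `τ` by the parity of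
`m + n` gives theta series of modulus `2τ` in the sum and the difference of the arguments. -/
theorem thetaChar_mul {τ : ℂ} (hτ : 0 < τ.im) (c d x y : ℂ) :
    thetaChar τ c x * thetaChar τ d y =
      thetaChar (2 * τ) ((c + d) / 2) (x + y) * thetaChar (2 * τ) ((c - d) / 2) (x - y) +
      thetaChar (2 * τ) ((c + d + 1) / 2) (x + y) *
        thetaChar (2 * τ) ((c - d + 1) / 2) (x - y) := by
  have h2 : 0 < (2 * τ).im := by simpa using hτ
  have key : ∀ c d x y σ : ℂ, 0 < σ.im → HasSum (fun p : ℤ × ℤ =>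
      exp (Real.pi * I * σ * (p.1 + c) ^ 2 + 2 * Real.pi * I * (p.1 + c) * x) *
      exp (Real.pi * I * σ * (p.2 + d) ^ 2 + 2 * Real.pi * I * (p.2 + d) * y))
      (thetaChar σ c x * thetaChar σ d y) := by
    intro c d x y σ hσ
    have h1 := (summable_thetaChar hσ c x).norm
    have h2 := (summable_thetaChar hσ d y).norm
    rw [thetaChar, thetaChar, tsum_mul_tsum_of_summable_norm h1 h2]
    exact (summable_mul_of_summable_norm h1 h2).hasSum
  have h := (sumDiffEquiv.hasSum_iff).2 (key c d x y τ hτ)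
  refine h.unique (HasSum.sum ?_ ?_)
  · convert key ((c + d) / 2) ((c - d) / 2) (x + y) (x - y) (2 * τ) h2 using 2 with p
    simp only [Function.comp_apply, sumDiffEquiv_inl, ← exp_add, Int.cast_add, Int.cast_sub]
    congr 1
    ring
  · convert key ((c + d + 1) / 2) ((c - d + 1) / 2) (x + y) (x - y) (2 * τ) h2 using 2 with p
    simp only [Function.comp_apply, sumDiffEquiv_inr, ← exp_add, Int.cast_add, Int.cast_sub,
      Int.cast_one]
    congr 1
    ring

/-! ### The four Jacobi theta functions as theta series -/

theorem neg_one_zpow_eq_exp (k : ℤ) : (-1 : ℂ) ^ k = exp (Real.pi * I * k) := by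
  rw [← exp_pi_mul_I, ← exp_int_mul]
  congr 1
  ring

theorem exp_pi_mul_I_div_two : exp (Real.pi * I / 2) = I := by
  rw [mul_div_right_comm, exp_pi_div_two_mul_I]

theorem theta2_eq_thetaChar (τ x : ℂ) : theta2 τ x = thetaChar τ (1 / 2) x := by
  refine tsum_congr fun k => ?_
  rw [← exp_add]
  congr 1
  ring

theorem theta3_eq_thetaChar (τ x : ℂ) : theta3 τ x = thetaChar τ 0 x := by
  refine tsum_congr fun k => ?_
  rw [← exp_add]
  congr 1
  ring

theorem theta4_eq_thetaChar (τ x : ℂ) : theta4 τ x = thetaChar τ 0 (x + 1 / 2) := by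
  refine tsum_congr fun k => ?_
  rw [neg_one_zpow_eq_exp, ← exp_add, ← exp_add]
  congr 1
  ring

theorem theta1_eq_thetaChar (τ x : ℂ) : theta1 τ x = -thetaChar τ (1 / 2) (x + 1 / 2) := by
  unfold theta1 thetaChar
  rw [neg_mul, ← tsum_mul_left]
  congr 1
  refine tsum_congr fun k => ?_
  nth_rewrite 1 [← exp_pi_mul_I_div_two]
  rw [neg_one_zpow_eq_exp, ← exp_add, ← exp_add, ← exp_add]
  congr 1
  ring

/-! ### Parity and half-period shifts -/

theorem thetaChar_half_add_one (τ x : ℂ) :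
    thetaChar τ (1 / 2) (x + 1) = -thetaChar τ (1 / 2) x := by
  rw [thetaChar_add_one, show 2 * (Real.pi : ℂ) * I * (1 / 2) = Real.pi * I by ring, exp_pi_mul_I,
    neg_one_mul]

theorem thetaChar_zero_add_one (τ x : ℂ) : thetaChar τ 0 (x + 1) = thetaChar τ 0 x := by
  rw [thetaChar_add_one, mul_zero, exp_zero, one_mul]

theorem thetaChar_one (τ x : ℂ) : thetaChar τ 1 x = thetaChar τ 0 x := by
  rw [← thetaChar_char_add_one τ 0, zero_add]

theorem theta2_neg (τ x : ℂ) : theta2 τ (-x) = theta2 τ x := by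
  rw [theta2_eq_thetaChar, theta2_eq_thetaChar, ← thetaChar_neg, neg_neg,
    ← thetaChar_char_add_one]
  norm_num

theorem theta3_neg (τ x : ℂ) : theta3 τ (-x) = theta3 τ x := by
  rw [theta3_eq_thetaChar, theta3_eq_thetaChar, ← thetaChar_neg, neg_neg, neg_zero]

theorem theta1_add_half (τ x : ℂ) : theta1 τ (x + 1 / 2) = theta2 τ x := by
  rw [theta1_eq_thetaChar, theta2_eq_thetaChar, add_assoc, add_halves, thetaChar_half_add_one,
    neg_neg]

theorem theta2_add_half (τ x : ℂ) : theta2 τ (x + 1 / 2) = -theta1 τ x := by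
  rw [theta1_eq_thetaChar, theta2_eq_thetaChar, neg_neg]

theorem theta3_add_half (τ x : ℂ) : theta3 τ (x + 1 / 2) = theta4 τ x := by
  rw [theta4_eq_thetaChar, theta3_eq_thetaChar]

theorem theta4_add_half (τ x : ℂ) : theta4 τ (x + 1 / 2) = theta3 τ x := by
  rw [theta4_eq_thetaChar, theta3_eq_thetaChar, add_assoc, add_halves, thetaChar_zero_add_one]

theorem theta4_neg (τ x : ℂ) : theta4 τ (-x) = theta4 τ x := by
  rw [← theta3_add_half, ← theta3_neg, ← theta4_add_half]
  congr 1
  ring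

theorem theta1_neg (τ x : ℂ) : theta1 τ (-x) = -theta1 τ x := by
  rw [← theta2_add_half, ← theta2_neg, ← theta1_add_half]
  congr 1
  ring

theorem theta1_zero (τ : ℂ) : theta1 τ 0 = 0 := by
  have h := theta1_neg τ 0
  rw [neg_zero] at h
  exact self_eq_neg.mp h

/-! ### Products of theta functions in terms of the modulus `2τ` -/

theorem theta3_mul_theta3 {τ : ℂ} (hτ : 0 < τ.im) (x y : ℂ) : theta3 τ x * theta3 τ y =
    theta3 (2 * τ) (x + y) * theta3 (2 * τ) (x - y) +
      theta2 (2 * τ) (x + y) * theta2 (2 * τ) (x - y) := by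
  simp only [theta3_eq_thetaChar, theta2_eq_thetaChar, thetaChar_mul hτ]
  norm_num

theorem theta2_mul_theta2 {τ : ℂ} (hτ : 0 < τ.im) (x y : ℂ) : theta2 τ x * theta2 τ y =
    theta3 (2 * τ) (x + y) * theta2 (2 * τ) (x - y) +
      theta2 (2 * τ) (x + y) * theta3 (2 * τ) (x - y) := by
  simp only [theta3_eq_thetaChar, theta2_eq_thetaChar, thetaChar_mul hτ]
  norm_num [thetaChar_one]
  ring

theorem theta3_add_one (τ x : ℂ) : theta3 τ (x + 1) = theta3 τ x := by
  simp only [theta3_eq_thetaChar, thetaChar_zero_add_one]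

theorem theta2_add_one (τ x : ℂ) : theta2 τ (x + 1) = -theta2 τ x := by
  simp only [theta2_eq_thetaChar, thetaChar_half_add_one]

theorem theta4_mul_theta4 {τ : ℂ} (hτ : 0 < τ.im) (x y : ℂ) : theta4 τ x * theta4 τ y =
    theta3 (2 * τ) (x + y) * theta3 (2 * τ) (x - y) -
      theta2 (2 * τ) (x + y) * theta2 (2 * τ) (x - y) := by
  rw [← theta3_add_half, ← theta3_add_half, theta3_mul_theta3 hτ,
    show x + 1 / 2 + (y + 1 / 2) = x + y + 1 by ring,
    show x + 1 / 2 - (y + 1 / 2) = x - y by ring, theta3_add_one, theta2_add_one]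
  ring

theorem theta1_mul_theta1 {τ : ℂ} (hτ : 0 < τ.im) (x y : ℂ) : theta1 τ x * theta1 τ y =
    theta3 (2 * τ) (x + y) * theta2 (2 * τ) (x - y) -
      theta2 (2 * τ) (x + y) * theta3 (2 * τ) (x - y) := by
  rw [← neg_neg (theta1 τ x), ← neg_neg (theta1 τ y), ← theta2_add_half, ← theta2_add_half,
    neg_mul_neg, theta2_mul_theta2 hτ,
    show x + 1 / 2 + (y + 1 / 2) = x + y + 1 by ring,
    show x + 1 / 2 - (y + 1 / 2) = x - y by ring, theta3_add_one, theta2_add_one]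
  ring

theorem theta3_mul_theta4 {τ : ℂ} (hτ : 0 < τ.im) (x y : ℂ) : theta3 τ x * theta4 τ y =
    theta4 (2 * τ) (x + y) * theta4 (2 * τ) (x - y) -
      theta1 (2 * τ) (x + y) * theta1 (2 * τ) (x - y) := by
  rw [← theta3_add_half, theta3_mul_theta3 hτ, ← theta4_add_half (2 * τ) (x - _),
    ← theta1_add_half (2 * τ) (x - _), ← add_assoc, theta3_add_half, theta2_add_half,
    show x - (y + 1 / 2) + 1 / 2 = x - y by ring]
  ring

theorem theta1_mul_theta2 {τ : ℂ} (hτ : 0 < τ.im) (x y : ℂ) : theta1 τ x * theta2 τ y =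
    theta1 (2 * τ) (x + y) * theta4 (2 * τ) (x - y) +
      theta4 (2 * τ) (x + y) * theta1 (2 * τ) (x - y) := by
  rw [← neg_neg (theta1 τ x), ← theta2_add_half, neg_mul, theta2_mul_theta2 hτ,
    add_right_comm, add_sub_right_comm, theta2_add_half, theta2_add_half, theta3_add_half,
    theta3_add_half]
  ring

/-! ### Nonvanishing of the theta constants -/

theorem theta4_zero_eq_jacobiTheta (τ : ℂ) : theta4 τ 0 = jacobiTheta (τ + 1) := by
  rw [theta4, jacobiTheta]
  refine tsum_congr fun k => ?_
  rw [neg_one_zpow_eq_exp, ← exp_add, ← exp_add, Complex.exp_eq_exp_iff_exists_int]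
  -- `k² - k` is even, so `(-1) ^ k = exp (π i k²)`.
  obtain ⟨r, hr⟩ := Int.even_mul_succ_self (k - 1)
  refine ⟨-r, ?_⟩
  have hr' : ((k : ℂ) - 1) * (k - 1 + 1) = r + r := by exact_mod_cast hr
  push_cast
  linear_combination (-Real.pi * I) * hr'

theorem theta3_zero_eq_jacobiTheta (τ : ℂ) : theta3 τ 0 = jacobiTheta τ := by
  rw [theta3, jacobiTheta]
  refine tsum_congr fun k => ?_
  rw [mul_zero, exp_zero, mul_one]
  congr 1
  ring

/-- This is `θ₃(0|τ) θ₄(0|τ) = θ₄(0|2τ)²`. -/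
theorem jacobiTheta_mul_add_one {τ : ℂ} (hτ : 0 < τ.im) :
    jacobiTheta τ * jacobiTheta (τ + 1) = jacobiTheta (2 * τ + 1) ^ 2 := by
  rw [← theta4_zero_eq_jacobiTheta, ← theta4_zero_eq_jacobiTheta, ← theta3_zero_eq_jacobiTheta,
    theta3_mul_theta4 hτ, add_zero, sub_zero, theta1_zero]
  ring

/-- A zero `τ` of `jacobiTheta` would give the zeros `2τ + 1`, `2(2τ + 1) + 1`, …, with imaginary
parts tending to infinity, where `jacobiTheta` tends to `1`. -/
theorem jacobiTheta_ne_zero {τ : ℂ} (hτ : 0 < τ.im) : jacobiTheta τ ≠ 0 := by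
  intro h0
  have hiter : ∀ n : ℕ, ∃ σ : ℂ, σ.im = 2 ^ n * τ.im ∧ jacobiTheta σ = 0 := by
    intro n
    induction n with
    | zero => exact ⟨τ, by simp, h0⟩
    | succ n ih =>
      obtain ⟨σ, hσ, hz⟩ := ih
      have hpos : 0 < σ.im := by rw [hσ]; positivity
      refine ⟨2 * σ + 1, ?_, ?_⟩
      · simp [hσ, pow_succ]
        ring
      · have := jacobiTheta_mul_add_one hpos
        rw [hz, zero_mul] at this
        exact pow_eq_zero_iff two_ne_zero |>.1 this.symm
  choose σ hσ hz using hiter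
  have him : Filter.Tendsto (fun n => (σ n).im) Filter.atTop Filter.atTop := by
    simp only [hσ]
    exact (tendsto_pow_atTop_atTop_of_one_lt one_lt_two).atTop_mul_const hτ
  have hexp : Filter.Tendsto (fun y : ℝ => Real.exp (-Real.pi * y)) Filter.atTop (nhds 0) :=
    Real.tendsto_exp_atBot.comp
      (Filter.tendsto_id.const_mul_atTop_of_neg (neg_lt_zero.2 Real.pi_pos))
  have hlim := isBigO_at_im_infty_jacobiTheta_sub_one.trans_tendsto
    (hexp.comp Filter.tendsto_comap)
  have h1 := hlim.comp (Filter.tendsto_comap_iff.2 him)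
  have h2 : (fun τ => jacobiTheta τ - 1) ∘ σ = fun _ => (-1 : ℂ) := by
    funext n
    simp [hz]
  rw [h2] at h1
  exact neg_ne_zero.2 one_ne_zero (tendsto_nhds_unique tendsto_const_nhds h1)

theorem theta3_zero_ne_zero {τ : ℂ} (hτ : 0 < τ.im) : theta3 τ 0 ≠ 0 := by
  rw [theta3_zero_eq_jacobiTheta]
  exact jacobiTheta_ne_zero hτ

theorem theta4_zero_ne_zero {τ : ℂ} (hτ : 0 < τ.im) : theta4 τ 0 ≠ 0 := by
  rw [theta4_zero_eq_jacobiTheta]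
  exact jacobiTheta_ne_zero (by simpa using hτ)

/-- The inversion `τ ↦ -1/τ` exchanges the zero values of `θ₂` and `θ₄`. -/
theorem theta2_zero_ne_zero {τ : ℂ} (hτ : 0 < τ.im) : theta2 τ 0 ≠ 0 := by
  have h0 : τ ≠ 0 := by rintro rfl; simp at hτ
  have him : 0 < (-1 / τ).im := by
    rw [neg_div, neg_im, one_div, inv_im, neg_div, neg_neg]
    exact div_pos hτ (normSq_pos.2 h0)
  rw [theta2_eq_thetaChar, thetaChar_eq_jacobiTheta₂, jacobiTheta₂_functional_equation]
  have h4 := theta4_zero_ne_zero him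
  rw [theta4_eq_thetaChar, thetaChar_eq_jacobiTheta₂] at h4
  -- `θ₂(0|τ)` is a multiple of `jacobiTheta₂ (τ / 2) τ`, which inversion turns into a multiple of
  -- `jacobiTheta₂ (1 / 2) (-1 / τ) = θ₄(0|-1/τ)`.
  have harg : (0 + 1 / 2 * τ) / τ = 0 + 1 / 2 + 0 * (-1 / τ) := by field_simp; ring
  rw [harg]
  refine mul_ne_zero (exp_ne_zero _) (mul_ne_zero (mul_ne_zero ?_ (exp_ne_zero _))
    (right_ne_zero_of_mul h4))
  exact one_div_ne_zero ((cpow_ne_zero_iff_of_exponent_ne_zero (by norm_num)).2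
    (mul_ne_zero (neg_ne_zero.2 I_ne_zero) h0))

/-- The duplication formula of `θ₁`. -/
theorem theta1_two_mul {τ : ℂ} (hτ : 0 < τ.im) (x : ℂ) :
    theta1 τ (2 * x) * (theta2 τ 0 * theta3 τ 0 * theta4 τ 0) =
      2 * (theta1 τ x * theta2 τ x * theta3 τ x * theta4 τ x) := by
  have h1 := theta1_mul_theta2 hτ (2 * x) 0
  have h2 := theta3_mul_theta4 hτ 0 0
  have h3 := theta1_mul_theta2 hτ x x
  have h4 := theta3_mul_theta4 hτ x x
  simp only [← two_mul, mul_zero, add_zero, sub_zero, sub_self, theta1_zero] at h1 h2 h3 h4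
  linear_combination theta3 τ 0 * theta4 τ 0 * h1 +
    2 * theta1 (2 * τ) (2 * x) * theta4 (2 * τ) (2 * x) * h2
    - 2 * theta3 τ x * theta4 τ x * h3
    - 2 * theta1 (2 * τ) (2 * x) * theta4 (2 * τ) 0 * h4

theorem differentiable_thetaChar {τ : ℂ} (hτ : 0 < τ.im) (c : ℂ) :
    Differentiable ℂ (thetaChar τ c) := by
  intro x
  rw [funext (thetaChar_eq_jacobiTheta₂ τ c)]
  have h := (differentiableAt_jacobiTheta₂_fst (x + c * τ) hτ).comp x
    ((differentiableAt_id (x := x)).add_const (c * τ))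
  have h' : DifferentiableAt ℂ (fun x => jacobiTheta₂ (x + c * τ) τ) x := h
  fun_prop

theorem differentiable_theta1 {τ : ℂ} (hτ : 0 < τ.im) : Differentiable ℂ (theta1 τ) := by
  rw [funext (theta1_eq_thetaChar τ)]
  have := differentiable_thetaChar hτ (1 / 2)
  fun_prop

theorem differentiable_theta2 {τ : ℂ} (hτ : 0 < τ.im) : Differentiable ℂ (theta2 τ) := by
  rw [funext (theta2_eq_thetaChar τ)]
  exact differentiable_thetaChar hτ _

theorem differentiable_theta3 {τ : ℂ} (hτ : 0 < τ.im) : Differentiable ℂ (theta3 τ) := by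
  rw [funext (theta3_eq_thetaChar τ)]
  exact differentiable_thetaChar hτ _

theorem differentiable_theta4 {τ : ℂ} (hτ : 0 < τ.im) : Differentiable ℂ (theta4 τ) := by
  rw [funext (theta4_eq_thetaChar τ)]
  have := differentiable_thetaChar hτ 0
  fun_prop

/-- If `θ₁` vanishes to order `n` at `0`, comparing leading coefficients in the duplication formula
gives `2ⁿ = 2`, so the zero is simple. -/
theorem theta1Deriv_ne_zero {τ : ℂ} (hτ : 0 < τ.im) : theta1Deriv τ ≠ 0 := by
  have han : AnalyticAt ℂ (theta1 τ) 0 :=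
    (differentiable_theta1 hτ).analyticAt 0
  have hnz : ¬∀ᶠ z in nhds 0, theta1 τ z = 0 := by
    intro h
    have hall : theta1 τ = 0 := by
      refine AnalyticOnNhd.eq_of_eventuallyEq (z₀ := 0)
        (fun z _ => (differentiable_theta1 hτ).analyticAt z) (fun z _ => analyticAt_const) h
    apply theta2_zero_ne_zero hτ
    rw [← theta1_add_half, hall, Pi.zero_apply]
  obtain ⟨n, g, hg, hg0, hfg⟩ := han.exists_eventuallyEq_pow_smul_nonzero_iff.2 hnz
  simp only [sub_zero, smul_eq_mul] at hfg
  set C := theta2 τ 0 * theta3 τ 0 * theta4 τ 0 with hC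
  have hC0 : C ≠ 0 := mul_ne_zero (mul_ne_zero (theta2_zero_ne_zero hτ) (theta3_zero_ne_zero hτ))
    (theta4_zero_ne_zero hτ)
  have hdouble : Filter.Tendsto (fun x : ℂ => 2 * x) (nhds 0) (nhds 0) := by
    have : Continuous fun x : ℂ => 2 * x := by fun_prop
    simpa using this.tendsto 0
  have hev : ∀ᶠ x in nhdsWithin (0 : ℂ) {0}ᶜ,
      2 ^ n * g (2 * x) * C = 2 * g x * (theta2 τ x * theta3 τ x * theta4 τ x) := by
    filter_upwards [hfg.filter_mono nhdsWithin_le_nhds,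
      (hdouble.eventually hfg).filter_mono nhdsWithin_le_nhds,
      self_mem_nhdsWithin] with x h1 h2 hx
    have h := theta1_two_mul hτ x
    rw [h1, h2] at h
    refine mul_left_cancel₀ (pow_ne_zero n hx) ?_
    linear_combination h
  have hgc := hg.continuousAt
  have hl : Filter.Tendsto (fun x => 2 ^ n * g (2 * x) * C) (nhdsWithin (0 : ℂ) {0}ᶜ)
      (nhds (2 ^ n * g 0 * C)) :=
    (((hgc.tendsto.comp hdouble).const_mul _).mul_const _).mono_left nhdsWithin_le_nhds
  have hr : Filter.Tendsto (fun x => 2 * g x * (theta2 τ x * theta3 τ x * theta4 τ x))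
      (nhdsWithin (0 : ℂ) {0}ᶜ) (nhds (2 * g 0 * C)) :=
    ((hgc.tendsto.const_mul _).mul
      ((((differentiable_theta2 hτ).continuous.mul (differentiable_theta3 hτ).continuous).mul
        (differentiable_theta4 hτ).continuous).tendsto 0)).mono_left nhdsWithin_le_nhds
  have heq : (2 : ℂ) ^ n * g 0 * C = 2 * g 0 * C :=
    tendsto_nhds_unique hl (hr.congr' (hev.mono fun _ h => h.symm))
  have hn : n = 1 := by
    have h2 : (2 : ℂ) ^ n = 2 := mul_right_cancel₀ hg0 (mul_right_cancel₀ hC0 heq)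
    have h2' : 2 ^ n = 2 ^ 1 := by exact_mod_cast h2
    exact Nat.pow_right_injective le_rfl h2'
  subst hn
  have hd : HasDerivAt (fun z => z ^ 1 * g z) (g 0) 0 := by
    simpa using (hasDerivAt_pow 1 (0 : ℂ)).fun_mul hg.differentiableAt.hasDerivAt
  rw [theta1Deriv, Filter.EventuallyEq.deriv_eq hfg, hd.deriv]
  exact hg0

/-! ### The functions `φ_a` as ratios of theta functions -/

/-- `thetaFn τ a` is the theta function obtained, up to an exponential factor, by shifting `θ₁`
by the half-period `ω_a`; so the index `a` stands for `θ_{a+1}`. -/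
def thetaFn (τ : ℂ) : Fin 4 → ℂ → ℂ := ![theta1 τ, theta2 τ, theta3 τ, theta4 τ]

theorem theta1_add_halfPeriod (τ : ℂ) (a : Fin 4) : ∃ C : ℂ, C ≠ 0 ∧ ∀ y,
    theta1 τ (y + halfPeriod τ a) =
      C * exp (-(2 * Real.pi * I * y * halfPeriodSlope a)) * thetaFn τ a y := by
  fin_cases a
  · exact ⟨1, one_ne_zero, fun y => by simp [halfPeriod, halfPeriodSlope, thetaFn]⟩
  · refine ⟨1, one_ne_zero, fun y => ?_⟩
    simp [halfPeriod, halfPeriodSlope, thetaFn, ← theta1_add_half]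
  · refine ⟨-exp (-(Real.pi * I * τ / 4 + Real.pi * I)), neg_ne_zero.2 (exp_ne_zero _),
      fun y => ?_⟩
    simp only [halfPeriod, halfPeriodSlope, thetaFn, Fin.reduceFinMk, cons_val]
    rw [theta1_eq_thetaChar, theta3_eq_thetaChar,
      show y + (1 + τ) / 2 + 1 / 2 = y + 1 + 1 / 2 * τ by ring, thetaChar_add_mul_modulus,
      add_halves, thetaChar_one, thetaChar_zero_add_one, neg_mul, neg_mul, ← exp_add]
    congr 3
    ring
  · refine ⟨-exp (-(Real.pi * I * τ / 4 + Real.pi * I / 2)), neg_ne_zero.2 (exp_ne_zero _),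
      fun y => ?_⟩
    simp only [halfPeriod, halfPeriodSlope, thetaFn, Fin.reduceFinMk, cons_val]
    rw [theta1_eq_thetaChar, theta4_eq_thetaChar,
      show y + τ / 2 + 1 / 2 = y + 1 / 2 + 1 / 2 * τ by ring, thetaChar_add_mul_modulus,
      add_halves, thetaChar_one, neg_mul, neg_mul, ← exp_add]
    congr 3
    ring

/-- The factor `exp(2πi x ∂_τ ω_a)` in `φ_a` cancels the exponentials that come from shifting `θ₁`
in the numerator and the denominator. The identity needs no nonvanishing: both sides have the same
denominator up to a nonzero factor. -/
theorem varphi_eq_thetaFn (τ : ℂ) (a : Fin 4) (x u : ℂ) :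
    varphi τ a x u =
      theta1Deriv τ * thetaFn τ a (x + u) / (theta1 τ x * thetaFn τ a u) := by
  obtain ⟨C, hC, h⟩ := theta1_add_halfPeriod τ a
  rw [varphi, kronecker, ← add_assoc, h, h,
    show 2 * Real.pi * I * x * halfPeriodSlope a = -(2 * Real.pi * I * u * halfPeriodSlope a) -
      -(2 * Real.pi * I * (x + u) * halfPeriodSlope a) by ring, exp_sub]
  have h1 := exp_ne_zero (-(2 * Real.pi * I * u * halfPeriodSlope a))
  have h2 := exp_ne_zero (-(2 * Real.pi * I * (x + u) * halfPeriodSlope a))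
  generalize exp (-(2 * Real.pi * I * u * halfPeriodSlope a)) = e1 at h1 ⊢
  generalize exp (-(2 * Real.pi * I * (x + u) * halfPeriodSlope a)) = e2 at h2 ⊢
  rw [div_mul_div_comm, show e2 * (theta1 τ x * (C * e1 * thetaFn τ a u)) =
    C * e1 * e2 * (theta1 τ x * thetaFn τ a u) by ring,
    show e1 * (theta1Deriv τ * (C * e2 * thetaFn τ a (x + u))) =
    C * e1 * e2 * (theta1Deriv τ * thetaFn τ a (x + u)) by ring,
    mul_div_mul_left _ _ (mul_ne_zero (mul_ne_zero hC h1) h2)]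

theorem theta_ne_zero_of_theta1_two_mul_ne_zero {τ : ℂ} (hτ : 0 < τ.im) {x : ℂ}
    (hx : theta1 τ (2 * x) ≠ 0) :
    theta1 τ x ≠ 0 ∧ theta2 τ x ≠ 0 ∧ theta3 τ x ≠ 0 ∧ theta4 τ x ≠ 0 := by
  have h := theta1_two_mul hτ x
  refine ⟨?_, ?_, ?_, ?_⟩ <;> intro h0 <;>
    simp [h0, hx, theta2_zero_ne_zero hτ, theta3_zero_ne_zero hτ, theta4_zero_ne_zero hτ] at h

/-! ### Riemann relations and the duality of `v` -/

theorem theta_two_mul_add_mul_theta {τ : ℂ} (hτ : 0 < τ.im) (x y : ℂ) :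
    (theta1 τ (2 * x + y) * theta2 τ y = theta1 (2 * τ) (2 * x + 2 * y) * theta4 (2 * τ) (2 * x)
      + theta4 (2 * τ) (2 * x + 2 * y) * theta1 (2 * τ) (2 * x)) ∧
    (theta2 τ (2 * x + y) * theta1 τ y = theta1 (2 * τ) (2 * x + 2 * y) * theta4 (2 * τ) (2 * x)
      - theta4 (2 * τ) (2 * x + 2 * y) * theta1 (2 * τ) (2 * x)) ∧
    (theta3 τ (2 * x + y) * theta4 τ y = theta4 (2 * τ) (2 * x + 2 * y) * theta4 (2 * τ) (2 * x)
      - theta1 (2 * τ) (2 * x + 2 * y) * theta1 (2 * τ) (2 * x)) ∧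
    (theta4 τ (2 * x + y) * theta3 τ y = theta4 (2 * τ) (2 * x + 2 * y) * theta4 (2 * τ) (2 * x)
      + theta1 (2 * τ) (2 * x + 2 * y) * theta1 (2 * τ) (2 * x)) ∧
    theta1 τ y * theta2 τ y = theta1 (2 * τ) (2 * y) * theta4 (2 * τ) 0 ∧
    theta3 τ y * theta4 τ y = theta4 (2 * τ) (2 * y) * theta4 (2 * τ) 0 := by
  have e1 : 2 * x + y + y = 2 * x + 2 * y := by ring
  have e2 : y + (2 * x + y) = 2 * x + 2 * y := by ring
  have e3 : y - (2 * x + y) = -(2 * x) := by ring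
  refine ⟨?_, ?_, ?_, ?_, ?_, ?_⟩
  · rw [theta1_mul_theta2 hτ, e1, add_sub_cancel_right]
  · rw [mul_comm, theta1_mul_theta2 hτ, e2, e3, theta1_neg, theta4_neg]
    ring
  · rw [theta3_mul_theta4 hτ, e1, add_sub_cancel_right]
  · rw [mul_comm, theta3_mul_theta4 hτ, e2, e3, theta1_neg, theta4_neg]
    ring
  · rw [theta1_mul_theta2 hτ, sub_self, theta1_zero, two_mul y]
    ring
  · rw [theta3_mul_theta4 hτ, sub_self, theta1_zero, two_mul y]
    ring

/-- Four of Riemann's quartic theta relations, specialized to the arguments `(2x + y, y, y, y)` and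
`(2y + x, x, x, x)`. -/
theorem riemann_theta_relations {τ : ℂ} (hτ : 0 < τ.im) (x y : ℂ) :
    (theta1 τ (2 * x + y) * theta2 τ y * (theta3 τ y * theta4 τ y)
      + theta2 τ (2 * x + y) * theta1 τ y * (theta3 τ y * theta4 τ y)
      + theta3 τ (2 * x + y) * theta4 τ y * (theta1 τ y * theta2 τ y)
      + theta4 τ (2 * x + y) * theta3 τ y * (theta1 τ y * theta2 τ y)
      = 2 * (theta1 τ (2 * y + x) * theta2 τ x * (theta3 τ x * theta4 τ x))) ∧
    (theta1 τ (2 * x + y) * theta2 τ y * (theta3 τ y * theta4 τ y)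
      + theta2 τ (2 * x + y) * theta1 τ y * (theta3 τ y * theta4 τ y)
      - theta3 τ (2 * x + y) * theta4 τ y * (theta1 τ y * theta2 τ y)
      - theta4 τ (2 * x + y) * theta3 τ y * (theta1 τ y * theta2 τ y)
      = 2 * (theta2 τ (2 * y + x) * theta1 τ x * (theta3 τ x * theta4 τ x))) ∧
    (theta1 τ (2 * x + y) * theta2 τ y * (theta3 τ y * theta4 τ y)
      - theta2 τ (2 * x + y) * theta1 τ y * (theta3 τ y * theta4 τ y)
      + theta3 τ (2 * x + y) * theta4 τ y * (theta1 τ y * theta2 τ y)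
      - theta4 τ (2 * x + y) * theta3 τ y * (theta1 τ y * theta2 τ y)
      = 2 * (theta3 τ (2 * y + x) * theta4 τ x * (theta1 τ x * theta2 τ x))) ∧
    (theta1 τ (2 * x + y) * theta2 τ y * (theta3 τ y * theta4 τ y)
      - theta2 τ (2 * x + y) * theta1 τ y * (theta3 τ y * theta4 τ y)
      - theta3 τ (2 * x + y) * theta4 τ y * (theta1 τ y * theta2 τ y)
      + theta4 τ (2 * x + y) * theta3 τ y * (theta1 τ y * theta2 τ y)
      = 2 * (theta4 τ (2 * y + x) * theta3 τ x * (theta1 τ x * theta2 τ x))) := by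
  obtain ⟨a1, a2, a3, a4, a5, a6⟩ := theta_two_mul_add_mul_theta hτ x y
  obtain ⟨b1, b2, b3, b4, b5, b6⟩ := theta_two_mul_add_mul_theta hτ y x
  rw [add_comm (2 * y) (2 * x)] at b1 b2 b3 b4
  rw [a1, a2, a3, a4, a5, a6, b1, b2, b3, b4, b5, b6]
  refine ⟨?_, ?_, ?_, ?_⟩ <;> ring

theorem v_eq_sum (τ : ℂ) (ν : Fin 4 → ℂ) (x u : ℂ) :
    v τ ν x u = theta1Deriv τ / theta1 τ (2 * x) *
      (ν 0 * (theta1 τ (2 * x + u) / theta1 τ u) + ν 1 * (theta2 τ (2 * x + u) / theta2 τ u) +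
        ν 2 * (theta3 τ (2 * x + u) / theta3 τ u) + ν 3 * (theta4 τ (2 * x + u) / theta4 τ u)) := by
  simp only [v, varphi_eq_thetaFn, Fin.sum_univ_four, thetaFn, cons_val]
  ring

/-- The duality: over the common denominator `θ₁(2q) θ₁(2η)`, expanded by the duplication formula,
the coefficient of each `ν_a` is a Riemann relation. -/
theorem v_dual {τ : ℂ} (hτ : 0 < τ.im) (ν : Fin 4 → ℂ) {q η : ℂ}
    (hq : theta1 τ (2 * q) ≠ 0) (hη : theta1 τ (2 * η) ≠ 0) :
    v τ (dual ν) q η = v τ ν η q := by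
  obtain ⟨q1, q2, q3, q4⟩ := theta_ne_zero_of_theta1_two_mul_ne_zero hτ hq
  obtain ⟨e1, e2, e3, e4⟩ := theta_ne_zero_of_theta1_two_mul_ne_zero hτ hη
  have hK : theta2 τ 0 * theta3 τ 0 * theta4 τ 0 ≠ 0 :=
    mul_ne_zero (mul_ne_zero (theta2_zero_ne_zero hτ) (theta3_zero_ne_zero hτ))
      (theta4_zero_ne_zero hτ)
  obtain ⟨R1, R2, R3, R4⟩ := riemann_theta_relations hτ q η
  rw [v_eq_sum, v_eq_sum]
  have hdual0 : dual ν 0 = (ν 0 + ν 1 + ν 2 + ν 3) / 2 := by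
    simp [dual, mulVec, dotProduct, Fin.sum_univ_four]; ring
  have hdual1 : dual ν 1 = (ν 0 + ν 1 - ν 2 - ν 3) / 2 := by
    simp [dual, mulVec, dotProduct, Fin.sum_univ_four]; ring
  have hdual2 : dual ν 2 = (ν 0 - ν 1 + ν 2 - ν 3) / 2 := by
    simp [dual, mulVec, dotProduct, Fin.sum_univ_four]; ring
  have hdual3 : dual ν 3 = (ν 0 - ν 1 - ν 2 + ν 3) / 2 := by
    simp [dual, mulVec, dotProduct, Fin.sum_univ_four]; ring
  rw [hdual0, hdual1, hdual2, hdual3, eq_div_of_mul_eq hK (theta1_two_mul hτ q),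
    eq_div_of_mul_eq hK (theta1_two_mul hτ η)]
  field_simp
  linear_combination theta1Deriv τ * theta2 τ 0 * theta3 τ 0 * theta4 τ 0 *
    (ν 0 * R1 + ν 1 * R2 + ν 2 * R3 + ν 3 * R4)

/-! ### Addition formulas symmetrized in `w ↦ -w` -/

theorem theta2_theta1_symm {τ : ℂ} (hτ : 0 < τ.im) (z w : ℂ) :
    (theta2 τ (z - w) * theta1 τ (z + w) + theta2 τ (z + w) * theta1 τ (z - w)) *
      (theta3 τ 0 * theta4 τ 0) = 2 * (theta1 τ z * theta2 τ z * (theta3 τ w * theta4 τ w)) := by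
  have h1 := theta1_mul_theta2 hτ (z + w) (z - w)
  have h2 := theta1_mul_theta2 hτ (z - w) (z + w)
  have h3 := theta3_mul_theta4 hτ 0 0
  have h4 := theta1_mul_theta2 hτ z z
  have h5 := theta3_mul_theta4 hτ w w
  rw [show z + w + (z - w) = 2 * z by ring, show z + w - (z - w) = 2 * w by ring] at h1
  rw [show z - w + (z + w) = 2 * z by ring, show z - w - (z + w) = -(2 * w) by ring, theta4_neg,
    theta1_neg] at h2
  simp only [← two_mul, sub_self, theta1_zero, mul_zero, add_zero, sub_zero] at h3 h4 h5
  rw [mul_comm (theta2 τ (z - w)), mul_comm (theta2 τ (z + w)), h1, h2, h3, h4, h5]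
  ring

/-- Pairing `θ₁(z ± w)` with the constant `θ₂(0)` and `θ₃(z ∓ w)` with `θ₄(0)` leaves only products
`θ₁θ₂` and `θ₃θ₄`, which the modulus `2τ` resolves; `θ₁θ₃` itself would require another modulus. -/
theorem theta3_theta1_symm {τ : ℂ} (hτ : 0 < τ.im) (z w : ℂ) :
    (theta3 τ (z - w) * theta1 τ (z + w) + theta3 τ (z + w) * theta1 τ (z - w)) *
      (theta4 τ 0 * theta2 τ 0) = 2 * (theta1 τ z * theta3 τ z * (theta4 τ w * theta2 τ w)) := by
  have h1 := theta1_mul_theta2 hτ (z + w) 0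
  have h2 := theta1_mul_theta2 hτ (z - w) 0
  have h3 := theta3_mul_theta4 hτ (z + w) 0
  have h4 := theta3_mul_theta4 hτ (z - w) 0
  have h5 := theta1_mul_theta2 hτ z w
  have h6 := theta3_mul_theta4 hτ z w
  simp only [add_zero, sub_zero] at h1 h2 h3 h4
  linear_combination (theta3 τ (z - w) * theta4 τ 0) * h1 + (theta3 τ (z + w) * theta4 τ 0) * h2
    + 2 * theta4 (2 * τ) (z - w) * theta1 (2 * τ) (z - w) * h3
    + 2 * theta4 (2 * τ) (z + w) * theta1 (2 * τ) (z + w) * h4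
    - 2 * (theta3 τ z * theta4 τ w) * h5
    - 2 * (theta1 (2 * τ) (z + w) * theta4 (2 * τ) (z - w) +
      theta4 (2 * τ) (z + w) * theta1 (2 * τ) (z - w)) * h6

theorem theta4_theta1_symm {τ : ℂ} (hτ : 0 < τ.im) (z w : ℂ) :
    (theta4 τ (z - w) * theta1 τ (z + w) + theta4 τ (z + w) * theta1 τ (z - w)) *
      (theta2 τ 0 * theta3 τ 0) = 2 * (theta1 τ z * theta4 τ z * (theta2 τ w * theta3 τ w)) := by
  have h1 := theta1_mul_theta2 hτ (z + w) 0
  have h2 := theta1_mul_theta2 hτ (z - w) 0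
  have h3 := theta3_mul_theta4 hτ 0 (z + w)
  have h4 := theta3_mul_theta4 hτ 0 (z - w)
  have h5 := theta1_mul_theta2 hτ z w
  have h6 := theta3_mul_theta4 hτ w z
  simp only [add_zero, sub_zero, zero_add, zero_sub, theta1_neg, theta4_neg] at h1 h2 h3 h4
  rw [add_comm w z, ← neg_sub z w, theta1_neg, theta4_neg] at h6
  linear_combination (theta4 τ (z - w) * theta3 τ 0) * h1 + (theta4 τ (z + w) * theta3 τ 0) * h2
    + 2 * theta4 (2 * τ) (z - w) * theta1 (2 * τ) (z - w) * h3
    + 2 * theta4 (2 * τ) (z + w) * theta1 (2 * τ) (z + w) * h4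
    - 2 * (theta4 τ z * theta3 τ w) * h5
    - 2 * (theta1 (2 * τ) (z + w) * theta4 (2 * τ) (z - w) +
      theta4 (2 * τ) (z + w) * theta1 (2 * τ) (z - w)) * h6

theorem theta2_theta3_symm {τ : ℂ} (hτ : 0 < τ.im) (z w : ℂ) :
    (theta2 τ (z - w) * theta3 τ (z + w) + theta2 τ (z + w) * theta3 τ (z - w)) *
      (theta2 τ 0 * theta3 τ 0) = 2 * (theta2 τ z * theta3 τ z * (theta2 τ w * theta3 τ w)) := by
  have h1 := theta2_mul_theta2 hτ (z + w) 0
  have h2 := theta2_mul_theta2 hτ (z - w) 0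
  have h3 := theta3_mul_theta3 hτ (z + w) 0
  have h4 := theta3_mul_theta3 hτ (z - w) 0
  have h5 := theta2_mul_theta2 hτ z w
  have h6 := theta3_mul_theta3 hτ z w
  simp only [add_zero, sub_zero] at h1 h2 h3 h4
  rw [show (theta2 τ (z - w) * theta3 τ (z + w) + theta2 τ (z + w) * theta3 τ (z - w)) *
      (theta2 τ 0 * theta3 τ 0) =
      (theta2 τ (z - w) * theta2 τ 0) * (theta3 τ (z + w) * theta3 τ 0) +
      (theta2 τ (z + w) * theta2 τ 0) * (theta3 τ (z - w) * theta3 τ 0) by ring,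
    show theta2 τ z * theta3 τ z * (theta2 τ w * theta3 τ w) =
      (theta2 τ z * theta2 τ w) * (theta3 τ z * theta3 τ w) by ring, h1, h2, h3, h4, h5, h6]
  ring

theorem theta2_theta4_symm {τ : ℂ} (hτ : 0 < τ.im) (z w : ℂ) :
    (theta2 τ (z - w) * theta4 τ (z + w) + theta2 τ (z + w) * theta4 τ (z - w)) *
      (theta2 τ 0 * theta4 τ 0) = 2 * (theta2 τ z * theta4 τ z * (theta2 τ w * theta4 τ w)) := by
  have h1 := theta2_mul_theta2 hτ (z + w) 0
  have h2 := theta2_mul_theta2 hτ (z - w) 0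
  have h3 := theta4_mul_theta4 hτ (z + w) 0
  have h4 := theta4_mul_theta4 hτ (z - w) 0
  have h5 := theta2_mul_theta2 hτ z w
  have h6 := theta4_mul_theta4 hτ z w
  simp only [add_zero, sub_zero] at h1 h2 h3 h4
  rw [show (theta2 τ (z - w) * theta4 τ (z + w) + theta2 τ (z + w) * theta4 τ (z - w)) *
      (theta2 τ 0 * theta4 τ 0) =
      (theta2 τ (z - w) * theta2 τ 0) * (theta4 τ (z + w) * theta4 τ 0) +
      (theta2 τ (z + w) * theta2 τ 0) * (theta4 τ (z - w) * theta4 τ 0) by ring,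
    show theta2 τ z * theta4 τ z * (theta2 τ w * theta4 τ w) =
      (theta2 τ z * theta2 τ w) * (theta4 τ z * theta4 τ w) by ring, h1, h2, h3, h4, h5, h6]
  ring

theorem theta3_theta4_symm {τ : ℂ} (hτ : 0 < τ.im) (z w : ℂ) :
    (theta3 τ (z - w) * theta4 τ (z + w) + theta3 τ (z + w) * theta4 τ (z - w)) *
      (theta3 τ 0 * theta4 τ 0) = 2 * (theta3 τ z * theta4 τ z * (theta3 τ w * theta4 τ w)) := by
  have h1 := theta3_mul_theta3 hτ (z + w) 0
  have h2 := theta3_mul_theta3 hτ (z - w) 0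
  have h3 := theta4_mul_theta4 hτ (z + w) 0
  have h4 := theta4_mul_theta4 hτ (z - w) 0
  have h5 := theta3_mul_theta3 hτ z w
  have h6 := theta4_mul_theta4 hτ z w
  simp only [add_zero, sub_zero] at h1 h2 h3 h4
  rw [show (theta3 τ (z - w) * theta4 τ (z + w) + theta3 τ (z + w) * theta4 τ (z - w)) *
      (theta3 τ 0 * theta4 τ 0) =
      (theta3 τ (z - w) * theta3 τ 0) * (theta4 τ (z + w) * theta4 τ 0) +
      (theta3 τ (z + w) * theta3 τ 0) * (theta4 τ (z - w) * theta4 τ 0) by ring,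
    show theta3 τ z * theta4 τ z * (theta3 τ w * theta4 τ w) =
      (theta3 τ z * theta3 τ w) * (theta4 τ z * theta4 τ w) by ring, h1, h2, h3, h4, h5, h6]
  ring

/-- The coefficient `1` of the last term is kept so that this formula and its analogues for `θ₃` and
`θ₄` share the shape, with a sign `ε`, that `gyrostat_coefficient` expects. -/
theorem theta2_add_mul_theta2_sub {τ : ℂ} (hτ : 0 < τ.im) (z w : ℂ) :
    theta2 τ 0 ^ 2 * (theta2 τ (z + w) * theta2 τ (z - w)) =
      theta2 τ z ^ 2 * theta2 τ w ^ 2 - 1 * (theta1 τ z ^ 2 * theta1 τ w ^ 2) := by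
  simp only [sq, theta2_mul_theta2 hτ, theta1_mul_theta1 hτ, ← two_mul, sub_self, mul_zero,
    show z + w + (z - w) = 2 * z by ring, show z + w - (z - w) = 2 * w by ring]
  ring

theorem theta3_add_mul_theta3_sub {τ : ℂ} (hτ : 0 < τ.im) (z w : ℂ) :
    theta3 τ 0 ^ 2 * (theta3 τ (z + w) * theta3 τ (z - w)) =
      theta3 τ z ^ 2 * theta3 τ w ^ 2 - (-1) * (theta1 τ z ^ 2 * theta1 τ w ^ 2) := by
  simp only [sq, theta3_mul_theta3 hτ, theta1_mul_theta1 hτ, ← two_mul, sub_self, mul_zero,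
    show z + w + (z - w) = 2 * z by ring, show z + w - (z - w) = 2 * w by ring]
  ring

theorem theta4_add_mul_theta4_sub {τ : ℂ} (hτ : 0 < τ.im) (z w : ℂ) :
    theta4 τ 0 ^ 2 * (theta4 τ (z + w) * theta4 τ (z - w)) =
      theta4 τ z ^ 2 * theta4 τ w ^ 2 - 1 * (theta1 τ z ^ 2 * theta1 τ w ^ 2) := by
  simp only [sq, theta4_mul_theta4 hτ, theta1_mul_theta1 hτ, ← two_mul, sub_self, mul_zero,
    show z + w + (z - w) = 2 * z by ring, show z + w - (z - w) = 2 * w by ring]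
  ring

/-! ### The coefficients of the Pauli matrices -/

/-- The coefficient of a Pauli matrix, as an algebraic consequence of addition formulas. The letters
`t, w, p, m, o` are values of theta functions at `z`, `2q`, `z + 2q`, `z - 2q`, `0`; the suffix `1`
means `θ₁`, and the suffixes `a, b, c` mean `θ_{α+1}, θ_{β+1}, θ_{γ+1}`. `D` is `θ₁'(0)`, and
`n0, na, nb, nc` are the dual constants. The pair `κ, ε` accounts for the unit in
`c_α = -κ (θ_{α+1}(0) / θ₁'(0))²`: it is `1, 1` except for `θ₃`, where it is `i, -1`. -/
theorem gyrostat_coefficient {D oa ob oc t1 ta tb tc w1 wa wb wc p1 pa pb pc m1 ma mb mc κ ε : ℂ}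
    (n0 na nb nc g : ℂ)
    (hD : D ≠ 0) (hoa : oa ≠ 0) (hob : ob ≠ 0) (hoc : oc ≠ 0) (ht1 : t1 ≠ 0) (hta : ta ≠ 0)
    (htb : tb ≠ 0) (htc : tc ≠ 0) (hw1 : w1 ≠ 0) (hκ : κ ^ 2 * ε = 1)
    (h1 : (ma * p1 + pa * m1) * (ob * oc) = 2 * (t1 * ta * (wb * wc)))
    (ha : oa ^ 2 * (pa * ma) = ta ^ 2 * wa ^ 2 - ε * (t1 ^ 2 * w1 ^ 2))
    (hb : (ma * pb + pa * mb) * (oa * ob) = 2 * (ta * tb * (wa * wb)))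
    (hc : (ma * pc + pa * mc) * (oa * oc) = 2 * (ta * tc * (wa * wc)))
    {c φa φb φc ψ : ℂ} (hcdef : c = -κ * (oa / D) ^ 2) (hφa : φa = D * wa / (w1 * oa))
    (hφb : φb = D * wb / (w1 * ob)) (hφc : φc = D * wc / (w1 * oc)) (hψ : ψ = D * ta / (t1 * oa)) :
    t1 * w1 * ((c / 2 * g * φa + c * n0 * φb * φc + c * φa * (na * φa + nb * φb + nc * φc)) * ψ -
      na / c / ψ) = -(κ / 2) * (ta * wa * g + oa *
        (ma * (D / w1 * (n0 * (p1 / t1) + na * (pa / ta) + nb * (pb / tb) + nc * (pc / tc))) -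
         pa * (-(D / w1) *
          (n0 * (m1 / t1) + na * (ma / ta) + nb * (mb / tb) + nc * (mc / tc))))) := by
  have hκ0 : κ ≠ 0 := by rintro rfl; simp at hκ
  have hinv : na / c = -(na * (ε * κ * (D / oa) ^ 2)) := by
    rw [hcdef]
    field_simp
    linear_combination na * hκ
  have h1' := eq_div_of_mul_eq (mul_ne_zero hob hoc) h1
  have ha' := eq_div_of_mul_eq (pow_ne_zero 2 hoa) ((mul_comm _ _).trans ha)
  have hb' := eq_div_of_mul_eq (mul_ne_zero hoa hob) hb
  have hc' := eq_div_of_mul_eq (mul_ne_zero hoa hoc) hc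
  rw [show ma * (D / w1 * (n0 * (p1 / t1) + na * (pa / ta) + nb * (pb / tb) + nc * (pc / tc))) -
      pa * (-(D / w1) * (n0 * (m1 / t1) + na * (ma / ta) + nb * (mb / tb) + nc * (mc / tc))) =
      D / w1 * (n0 / t1 * (ma * p1 + pa * m1) + 2 * (na / ta) * (pa * ma) +
        nb / tb * (ma * pb + pa * mb) + nc / tc * (ma * pc + pa * mc)) by ring,
    h1', ha', hb', hc', hinv, hcdef, hφa, hφb, hφc, hψ]
  field_simp
  ring

theorem Xi_det {τ : ℂ} (hτ : 0 < τ.im) (q z : ℂ) :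
    (Xi τ q z).det = -(theta1 τ z * theta1 τ (2 * q)) := by
  rw [Xi, det_fin_two_of, theta1_mul_theta1 hτ]
  ring

theorem varphi₁_eq (τ x : ℂ) (α : Fin 3) : varphi₁ τ α x =
    theta1Deriv τ * thetaFn τ α.succ x / (theta1 τ x * thetaFn τ α.succ 0) := by
  rw [varphi₁, varphi_eq_thetaFn, add_zero]

theorem thetaFn_succ_zero_ne_zero {τ : ℂ} (hτ : 0 < τ.im) (α : Fin 3) :
    thetaFn τ α.succ 0 ≠ 0 := by
  fin_cases α
  · exact theta2_zero_ne_zero hτ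
  · exact theta3_zero_ne_zero hτ
  · exact theta4_zero_ne_zero hτ

theorem thetaConst_ne_zero {τ : ℂ} (hτ : 0 < τ.im) (α : Fin 3) : thetaConst τ α ≠ 0 := by
  have h1 := theta1Deriv_ne_zero hτ
  have h2 := theta2_zero_ne_zero hτ
  have h3 := theta3_zero_ne_zero hτ
  have h4 := theta4_zero_ne_zero hτ
  fin_cases α <;> simp [thetaConst, h1, h2, h3, h4]

theorem varphi₁_ne_zero {τ : ℂ} (hτ : 0 < τ.im) {z : ℂ} (hz : theta1 τ (2 * z) ≠ 0)
    (α : Fin 3) : varphi₁ τ α z ≠ 0 := by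
  obtain ⟨z1, z2, z3, z4⟩ := theta_ne_zero_of_theta1_two_mul_ne_zero hτ hz
  rw [varphi₁_eq]
  refine div_ne_zero (mul_ne_zero (theta1Deriv_ne_zero hτ) ?_)
    (mul_ne_zero z1 (thetaFn_succ_zero_ne_zero hτ α))
  fin_cases α
  exacts [z2, z3, z4]

theorem S_zero (τ c η : ℂ) (ν : Fin 4 → ℂ) (p q : ℂ) : S τ c η ν p q 0 =
    thetaConst τ 0 / 2 *
      (v τ (dual ν) q η * exp (p / (2 * c)) - v τ (dual ν) (-q) η * exp (-p / (2 * c))) *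
      varphi₁ τ 0 (2 * q) +
    thetaConst τ 0 * dual ν 0 * varphi₁ τ 1 (2 * q) * varphi₁ τ 2 (2 * q) +
    thetaConst τ 0 * varphi₁ τ 0 (2 * q) * (dual ν 1 * varphi₁ τ 0 (2 * q) +
      dual ν 2 * varphi₁ τ 1 (2 * q) + dual ν 3 * varphi₁ τ 2 (2 * q)) := by
  rw [S, Fin.sum_univ_three]
  rfl

theorem S_one (τ c η : ℂ) (ν : Fin 4 → ℂ) (p q : ℂ) : S τ c η ν p q 1 =
    thetaConst τ 1 / 2 *
      (v τ (dual ν) q η * exp (p / (2 * c)) - v τ (dual ν) (-q) η * exp (-p / (2 * c))) *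
      varphi₁ τ 1 (2 * q) +
    thetaConst τ 1 * dual ν 0 * varphi₁ τ 2 (2 * q) * varphi₁ τ 0 (2 * q) +
    thetaConst τ 1 * varphi₁ τ 1 (2 * q) * (dual ν 1 * varphi₁ τ 0 (2 * q) +
      dual ν 2 * varphi₁ τ 1 (2 * q) + dual ν 3 * varphi₁ τ 2 (2 * q)) := by
  rw [S, Fin.sum_univ_three]
  rfl

theorem S_two (τ c η : ℂ) (ν : Fin 4 → ℂ) (p q : ℂ) : S τ c η ν p q 2 =
    thetaConst τ 2 / 2 *
      (v τ (dual ν) q η * exp (p / (2 * c)) - v τ (dual ν) (-q) η * exp (-p / (2 * c))) *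
      varphi₁ τ 2 (2 * q) +
    thetaConst τ 2 * dual ν 0 * varphi₁ τ 0 (2 * q) * varphi₁ τ 1 (2 * q) +
    thetaConst τ 2 * varphi₁ τ 2 (2 * q) * (dual ν 1 * varphi₁ τ 0 (2 * q) +
      dual ν 2 * varphi₁ τ 1 (2 * q) + dual ν 3 * varphi₁ τ 2 (2 * q)) := by
  rw [S, Fin.sum_univ_three]
  rfl

theorem theta1_two_mul_neg_ne_zero {τ q : ℂ} (hq : theta1 τ (2 * q) ≠ 0) :
    theta1 τ (2 * -q) ≠ 0 := by
  rw [mul_neg, theta1_neg]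
  exact neg_ne_zero.2 hq

/-- Each coefficient of the gyrostat Lax matrix, cleared of the denominator
`-det Ξ(z) = θ₁(z) θ₁(2q)`, in terms of the entries of `L`: the first summand comes from the
diagonal of `L`, the second from its off-diagonal. -/
theorem lax_coefficients {τ : ℂ} (hτ : 0 < τ.im) (ν : Fin 4 → ℂ) {q z η : ℂ}
    (hq : theta1 τ (2 * q) ≠ 0) (hz : theta1 τ (2 * z) ≠ 0) (hη : theta1 τ (2 * η) ≠ 0)
    (c p : ℂ) :
    (theta1 τ z * theta1 τ (2 * q) * (S τ c η ν p q 0 * varphi₁ τ 0 z -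
        dual ν 1 / thetaConst τ 0 / varphi₁ τ 0 z) =
      -(1 / 2) * (theta2 τ z * theta2 τ (2 * q) *
        (v τ ν η q * exp (p / (2 * c)) - v τ ν η (-q) * exp (-p / (2 * c))) +
        theta2 τ 0 * (theta2 τ (z - 2 * q) * v τ ν z q - theta2 τ (z + 2 * q) * v τ ν z (-q)))) ∧
    (theta1 τ z * theta1 τ (2 * q) * (S τ c η ν p q 1 * varphi₁ τ 1 z -
        dual ν 2 / thetaConst τ 1 / varphi₁ τ 1 z) =
      -(I / 2) * (theta3 τ z * theta3 τ (2 * q) *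
        (v τ ν η q * exp (p / (2 * c)) - v τ ν η (-q) * exp (-p / (2 * c))) +
        theta3 τ 0 * (theta3 τ (z - 2 * q) * v τ ν z q - theta3 τ (z + 2 * q) * v τ ν z (-q)))) ∧
    (theta1 τ z * theta1 τ (2 * q) * (S τ c η ν p q 2 * varphi₁ τ 2 z -
        dual ν 3 / thetaConst τ 2 / varphi₁ τ 2 z) =
      -(1 / 2) * (theta4 τ z * theta4 τ (2 * q) *
        (v τ ν η q * exp (p / (2 * c)) - v τ ν η (-q) * exp (-p / (2 * c))) +
        theta4 τ 0 * (theta4 τ (z - 2 * q) * v τ ν z q - theta4 τ (z + 2 * q) * v τ ν z (-q)))) := by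
  have hq' := theta1_two_mul_neg_ne_zero hq
  obtain ⟨z1, z2, z3, z4⟩ := theta_ne_zero_of_theta1_two_mul_ne_zero hτ hz
  have hD := theta1Deriv_ne_zero hτ
  have h2 := theta2_zero_ne_zero hτ
  have h3 := theta3_zero_ne_zero hτ
  have h4 := theta4_zero_ne_zero hτ
  rw [S_zero, S_one, S_two, ← v_dual hτ ν hq hz, ← v_dual hτ ν hq' hz, v_dual hτ ν hq hη,
    v_dual hτ ν hq' hη, v_eq_sum τ _ q z, v_eq_sum τ _ (-q) z, mul_neg, theta1_neg,
    add_comm (2 * q) z, neg_add_eq_sub, div_neg]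
  generalize v τ ν η q * exp (p / (2 * c)) - v τ ν η (-q) * exp (-p / (2 * c)) = g
  have b23 := theta2_theta3_symm hτ z (2 * q)
  have b24 := theta2_theta4_symm hτ z (2 * q)
  have b34 := theta3_theta4_symm hτ z (2 * q)
  -- The sums are symmetric in their two theta functions; `α` has to come first.
  have swap : ∀ {a b c d e f r s u t : ℂ}, (a * b + c * d) * (e * f) = 2 * (r * s * (u * t)) →
      (d * c + b * a) * (f * e) = 2 * (s * r * (t * u)) := fun h => by linear_combination h
  refine ⟨?_, ?_, ?_⟩
  · exact gyrostat_coefficient (κ := 1) (ε := 1) (dual ν 0) (dual ν 1) (dual ν 2) (dual ν 3) g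
      hD h2 h3 h4 z1 z2 z3 z4 hq (by ring) (theta2_theta1_symm hτ z (2 * q))
      (theta2_add_mul_theta2_sub hτ z (2 * q)) b23 b24
      (show thetaConst τ 0 = _ by simp [thetaConst]) (varphi₁_eq τ (2 * q) 0)
      (varphi₁_eq τ (2 * q) 1) (varphi₁_eq τ (2 * q) 2) (varphi₁_eq τ z 0)
  · have := gyrostat_coefficient (κ := I) (ε := -1) (dual ν 0) (dual ν 2) (dual ν 3) (dual ν 1) g
      hD h3 h4 h2 z1 z3 z4 z2 hq (by simp) (theta3_theta1_symm hτ z (2 * q))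
      (theta3_add_mul_theta3_sub hτ z (2 * q)) b34 (swap b23)
      (show thetaConst τ 1 = _ by simp [thetaConst]) (varphi₁_eq τ (2 * q) 1)
      (varphi₁_eq τ (2 * q) 2) (varphi₁_eq τ (2 * q) 0) (varphi₁_eq τ z 1)
    linear_combination this
  · have := gyrostat_coefficient (κ := 1) (ε := 1) (dual ν 0) (dual ν 3) (dual ν 1) (dual ν 2) g
      hD h4 h2 h3 z1 z4 z2 z3 hq (by ring) (theta4_theta1_symm hτ z (2 * q))
      (theta4_add_mul_theta4_sub hτ z (2 * q)) (swap b24) (swap b34)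
      (show thetaConst τ 2 = _ by simp [thetaConst]) (varphi₁_eq τ (2 * q) 2)
      (varphi₁_eq τ (2 * q) 0) (varphi₁_eq τ (2 * q) 1) (varphi₁_eq τ z 2)
    linear_combination this

/-! ### Conjugation by the IRF-Vertex matrix -/

theorem laxZhV_eq (τ S₀ : ℂ) (S : Fin 3 → ℂ) (ν : Fin 4 → ℂ) (z : ℂ) :
    laxZhV τ S₀ S (fun α => dual ν α.succ / thetaConst τ α) z =
      S₀ • (1 : Matrix (Fin 2) (Fin 2) ℂ) +
        ((S 0 * varphi₁ τ 0 z - dual ν 1 / thetaConst τ 0 / varphi₁ τ 0 z) • !![1, 0; 0, -1] +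
          (S 1 * varphi₁ τ 1 z - dual ν 2 / thetaConst τ 1 / varphi₁ τ 1 z) • !![0, -I; I, 0] +
          (S 2 * varphi₁ τ 2 z - dual ν 3 / thetaConst τ 2 / varphi₁ τ 2 z) • !![0, 1; 1, 0]) := by
  rw [laxZhV, Fin.sum_univ_three]
  rfl

theorem Xi_mul_laxRvD_mul_inv {τ : ℂ} (hτ : 0 < τ.im) (ν : Fin 4 → ℂ) {q z η : ℂ}
    (hq : theta1 τ (2 * q) ≠ 0) (hz : theta1 τ (2 * z) ≠ 0) (hη : theta1 τ (2 * η) ≠ 0)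
    (c p : ℂ) (hdet : (Xi τ q z).det ≠ 0) :
    Xi τ q z * laxRvD τ c η ν p q z * (Xi τ q z)⁻¹ =
      laxZhV τ (S0 τ c η ν p q) (S τ c η ν p q) (fun α => dual ν α.succ / thetaConst τ α) z := by
  have hq' := theta1_two_mul_neg_ne_zero hq
  obtain ⟨N1, N2, N3⟩ := lax_coefficients hτ ν hq hz hη c p
  have hadj : Xi τ q z * laxRvD τ c η ν p q z * (Xi τ q z).adjugate = (Xi τ q z).det •
      laxZhV τ (S0 τ c η ν p q) (S τ c η ν p q) (fun α => dual ν α.succ / thetaConst τ α) z := by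
    have hΔ : (Xi τ q z).det = _ := det_fin_two_of _ _ _ _
    have hΔ' := Xi_det hτ q z
    rw [laxZhV_eq, S0, v_dual hτ ν hq hη, v_dual hτ ν hq' hη]
    generalize S τ c η ν p q 0 * varphi₁ τ 0 z - dual ν 1 / thetaConst τ 0 / varphi₁ τ 0 z = n1
      at N1 ⊢
    generalize S τ c η ν p q 1 * varphi₁ τ 1 z - dual ν 2 / thetaConst τ 1 / varphi₁ τ 1 z = n2
      at N2 ⊢
    generalize S τ c η ν p q 2 * varphi₁ τ 2 z - dual ν 3 / thetaConst τ 2 / varphi₁ τ 2 z = n3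
      at N3 ⊢
    have m2 := theta2_mul_theta2 hτ 0 (z - 2 * q)
    have m3 := theta3_mul_theta3 hτ 0 (z - 2 * q)
    have m4 := theta4_mul_theta4 hτ 0 (z - 2 * q)
    have p2 := theta2_mul_theta2 hτ 0 (z + 2 * q)
    have p3 := theta3_mul_theta3 hτ 0 (z + 2 * q)
    have p4 := theta4_mul_theta4 hτ 0 (z + 2 * q)
    rw [zero_add, zero_sub, theta2_neg, theta3_neg] at m2 m3 m4 p2 p3 p4
    rw [mul_sub (theta2 τ 0), ← mul_assoc (theta2 τ 0), ← mul_assoc (theta2 τ 0), m2, p2,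
      theta2_mul_theta2 hτ, ← neg_eq_iff_eq_neg.2 hΔ', hΔ] at N1
    rw [mul_sub (theta3 τ 0), ← mul_assoc (theta3 τ 0), ← mul_assoc (theta3 τ 0), m3, p3,
      theta3_mul_theta3 hτ, ← neg_eq_iff_eq_neg.2 hΔ', hΔ] at N2
    rw [mul_sub (theta4 τ 0), ← mul_assoc (theta4 τ 0), ← mul_assoc (theta4 τ 0), m4, p4,
      theta4_mul_theta4 hτ, ← neg_eq_iff_eq_neg.2 hΔ', hΔ] at N3
    rw [hΔ, Xi, laxRvD, adjugate_fin_two_of]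
    have hI : ∀ {x y : ℂ}, x = -(I / 2) * y → -I * x = -(1 / 2) * y := fun {x y} h => by
      rw [h]
      linear_combination y / 2 * I_sq
    -- The upper right entry of the Pauli sum contains `-i` times the second coefficient.
    replace N2 := hI N2
    ext i j
    fin_cases i <;> fin_cases j <;> simp [mul_apply, Fin.sum_univ_two]
    · linear_combination N1
    · linear_combination N3 + N2
    · linear_combination N3 - N2
    · linear_combination -N1
  rw [Matrix.inv_def, Matrix.mul_smul, hadj, Ring.inverse_eq_inv', smul_smul, inv_mul_cancel₀ hdet,
    one_smul]

end Ruijsenaars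

end

theorem theorem1 (τ : ℂ) (hτ : 0 < τ.im) (c : ℂ) (hc : c ≠ 0) (ν : Fin 4 → ℂ)
    (η : ℂ) (hη : Ruijsenaars.theta1 τ (2 * η) ≠ 0)
    (p q : ℂ) (hq : Ruijsenaars.theta1 τ (2 * q) ≠ 0)
    (z : ℂ) (hz : Ruijsenaars.theta1 τ (2 * z) ≠ 0) :
    Ruijsenaars.v τ (Ruijsenaars.dual ν) q η = Ruijsenaars.v τ ν η q ∧
    (Ruijsenaars.Xi τ q z).det ≠ 0 ∧
    (∀ α : Fin 3, Ruijsenaars.thetaConst τ α ≠ 0) ∧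
    (∀ α : Fin 3, Ruijsenaars.varphi₁ τ α z ≠ 0) ∧
    Ruijsenaars.Xi τ q z * Ruijsenaars.laxRvD τ c η ν p q z * (Ruijsenaars.Xi τ q z)⁻¹ =
      Ruijsenaars.laxZhV τ (Ruijsenaars.S0 τ c η ν p q) (Ruijsenaars.S τ c η ν p q)
        (fun α => Ruijsenaars.dual ν α.succ / Ruijsenaars.thetaConst τ α) z := by
  have hdet : (Ruijsenaars.Xi τ q z).det ≠ 0 := by
    rw [Ruijsenaars.Xi_det hτ]
    exact neg_ne_zero.2
      (mul_ne_zero (Ruijsenaars.theta_ne_zero_of_theta1_two_mul_ne_zero hτ hz).1 hq)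
  exact ⟨Ruijsenaars.v_dual hτ ν hq hη, hdet, Ruijsenaars.thetaConst_ne_zero hτ,
    Ruijsenaars.varphi₁_ne_zero hτ hz, Ruijsenaars.Xi_mul_laxRvD_mul_inv hτ ν hq hz hη c p hdet⟩
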